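/- Let $n\ge 0$, $[n]=\{1,\dots,n\}$, and let $\mathcal B_n$ be the set of all set partitions of $[n]$. For $\sigma\in\mathcal B_n$ and $S\subseteq[n]$ let $\sigma_S$ be the restriction of $\sigma$ to $S$ and $\|\sigma_S\|$ the number of its partition elements. For disjoint $A,B\subseteq[n]$, $0^A1^B$ denotes the event that $\rho\in\{0,1\}^n$ equals $0$ on $A$ and $1$ on $B$; write $1^S$ for the event that $\rho$ equals $1$ on $S$. Let $(\nu_p)_{p\in(0,1)}$ be a family of probability measures on $\{0,1\}^n$ such that - every one-dimensional marginal of $\nu_p$ is $p\delta_1+(1-p)\delta_0$, for all $p\in(0,1)$; - for each $S\subseteq[n]$, the function $p\mapsto\nu_p(1^S)$ is differentiable at $p=1/2$, with derivative denoted $\nu'_{1/2}(1^S)$; - $\nu_p(0^S1^{T\setminus S})=\nu_{1-p}(0^{T\setminus S}1^S)$ for all $S\subseteq T\subseteq[n]$ and all $p\in(0,1)$. A vector $q^{(p)}\in\mathbb R^{\mathcal B_n}$ (not necessarily nonnegative) is called a formal solution at $p$ if $$\sum_{\sigma\in\mathcal B_n}p^{\|\sigma_S\|}q^{(p)}_\sigma=\nu_p(1^S)\qquad\text{for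 all } S\subseteq[n].$$ Then the set of all $q\in\mathbb R^{\mathcal B_n}$ that are a subsequential limit, as $p\to1/2$, of some family $(q^{(p)})_{p\in(0,1)}$ of formal solutions (that is, $q=\lim_k q^{(p_k)}$ for some sequence $p_k\in(0,1)\setminus\{1/2\}$ with $p_k\to1/2$) is exactly the set of solutions $q\in\mathbb R^{\mathcal B_n}$ of the linear system $$\begin{cases}\displaystyle\sum_{\sigma\in\mathcal B_n}2^{-\|\sigma_S\|}q_\sigma=\nu_{1/2}(1^S), & S\subseteq[n],\ |S|\text{ even},\\[2mm] \displaystyle\sum_{\sigma\in\mathcal B_n}\|\sigma_S\|\,2^{-\|\sigma_S\|+1}q_\sigma=\nu'_{1/2}(1^S), & S\subseteq[n],\ |S|\text{ odd}.\end{cases}$$ -/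

import Mathlib

open MeasureTheory Filter Topology

noncomputable section

/-- The set partitions `𝓑ₙ` of `[n]`. -/
abbrev SetPart (n : ℕ) : Type := Finpartition (Finset.univ : Finset (Fin n))

/-- `‖σ_S‖`: the number of partition elements of the restriction of `σ` to `S`
(for `S = ∅` this is `0`). -/
def restrictCard {n : ℕ} (σ : SetPart n) (S : Finset (Fin n)) : ℕ :=
  (σ.restrict (Finset.subset_univ S)).parts.card

/-- The event `0^S 1^T`: the binary string is `0` on `S` and `1` on `T`. -/
def zeroOneEvent {n : ℕ} (S T : Finset (Fin n)) : Set (Fin n → Fin 2) :=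
  {ρ | (∀ i ∈ S, ρ i = 0) ∧ ∀ i ∈ T, ρ i = 1}

/-- The event `1^S`: the binary string is `1` on `S`. -/
def onesEvent {n : ℕ} (S : Finset (Fin n)) : Set (Fin n → Fin 2) :=
  {ρ | ∀ i ∈ S, ρ i = 1}

/-- All one-dimensional marginals of `μ` equal `p δ₁ + (1 - p) δ₀`. -/
def HasBernoulliMarginals {n : ℕ} (μ : Measure (Fin n → Fin 2)) (p : ℝ) : Prop :=
  ∀ i : Fin n, μ.map (fun ρ => ρ i) =
    ENNReal.ofReal p • Measure.dirac 1 + ENNReal.ofReal (1 - p) • Measure.dirac 0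

/-- `q ∈ ℝ^{𝓑ₙ}` (with no sign condition) is a formal solution at parameter `p` for `μ`:
`∑_σ p^{‖σ_S‖} q_σ = μ(1^S)` for all `S ⊆ [n]`. -/
def IsFormalSolution {n : ℕ} (μ : Measure (Fin n → Fin 2)) (p : ℝ) (q : SetPart n → ℝ) : Prop :=
  ∀ S : Finset (Fin n), ∑ σ : SetPart n, p ^ restrictCard σ S * q σ = μ.real (onesEvent S)

/-- `q` is a subsequential limit, as `p → 1/2`, of the family `(Q p)`, `p ∈ (0,1)`: the limit
of `Q` along some sequence in `(0,1) \ {1/2}` that converges to `1/2`. -/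
def IsSubseqLimitAtHalf {n : ℕ} (Q : ℝ → SetPart n → ℝ) (q : SetPart n → ℝ) : Prop :=
  ∃ u : ℕ → ℝ, (∀ k, u k ∈ Set.Ioo (0 : ℝ) 1 ∧ u k ≠ 1 / 2) ∧
    Tendsto u atTop (𝓝 (1 / 2)) ∧ Tendsto (fun k => Q (u k)) atTop (𝓝 q)

end

/-! Colour the blocks of `σ` independently, 1 with probability `p`: then `p ^ ‖σ_S‖` is the
probability of `1^S`. Inclusion–exclusion and the flip symmetry therefore make any formal solution
at `p` one at `1 - p` too. Along a convergent sequence, continuity gives the equations at `1/2`, and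
symmetric difference quotients give the derivative equations.

Conversely, let `q` solve the system and let `d p S` be its defect. The relation `d (1 - p) T = ∑_{S
⊆ T} (-1)^|S| d p S` forces the equations of the missing parities
(`eq_zero_and_deriv_eq_zero_of_reflect`), so `d` is `o(p - 1/2)` for every `S`. For `|T| ≠ 1` there
is a signed vector `r T`, independent of `p`, whose transform is `p ^ |S \ T| * topWeight |T| p` on
`S ⊇ T` and zero elsewhere (`exists_signed_setPart`). Möbius inversion expands the defect in these
(`sum_correction`); the singleton coefficients vanish because the marginals are prescribed. As
`topWeight` has at most a simple zero at `1/2`, the correction to `q` tends to zero. -/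

/-! ### Block counts as numbers of colours -/

theorem restrictCard_eq_card_image {n : ℕ} (σ : SetPart n) (S : Finset (Fin n)) :
    restrictCard σ S = (S.image σ.part).card := by
  classical
  have h := σ.sum_restrict (Finset.subset_univ S) (fun t => if t = ⊥ then 0 else 1) (by simp)
  have h' : ∑ t ∈ (σ.restrict (Finset.subset_univ S)).parts, (if t = ⊥ then 0 else 1)
      = restrictCard σ S := by
    rw [restrictCard, Finset.card_eq_sum_ones]
    refine Finset.sum_congr rfl fun t ht => ?_
    rw [if_neg ((σ.restrict (Finset.subset_univ S)).ne_bot ht)]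
  rw [← h', h]
  have h2 : S.image σ.part = σ.parts.filter (fun t => ¬ t ⊓ S = ⊥) := by
    ext t
    simp only [Finset.mem_image, Finset.mem_filter]
    constructor
    · rintro ⟨i, hi, rfl⟩
      refine ⟨σ.part_mem.2 (Finset.mem_univ i), fun hb => ?_⟩
      have : i ∈ σ.part i ⊓ S := Finset.mem_inter.2 ⟨σ.mem_part_self.2 (Finset.mem_univ i), hi⟩
      rw [hb] at this
      simp at this
    · rintro ⟨ht, hb⟩
      obtain ⟨i, hi⟩ := Finset.nonempty_iff_ne_empty.2 hb
      obtain ⟨hit, hiS⟩ := Finset.mem_inter.1 hi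
      exact ⟨i, hiS, σ.part_eq_of_mem ht hit⟩
  rw [h2, Finset.card_filter]
  refine Finset.sum_congr rfl fun t _ => ?_
  by_cases h : t ⊓ S = ⊥ <;> simp [h]

theorem card_image_eq_of_eq_iff {α β γ : Type*} [DecidableEq β] [DecidableEq γ]
    {f : α → β} {g : α → γ} (h : ∀ i j, f i = f j ↔ g i = g j) (S : Finset α) :
    (S.image f).card = (S.image g).card := by
  classical
  refine Finset.card_bij' (fun b hb => g (Finset.mem_image.1 hb).choose)
    (fun c hc => f (Finset.mem_image.1 hc).choose) ?_ ?_ ?_ ?_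
  · intro b hb
    exact Finset.mem_image_of_mem _ (Finset.mem_image.1 hb).choose_spec.1
  · intro c hc
    exact Finset.mem_image_of_mem _ (Finset.mem_image.1 hc).choose_spec.1
  · intro b hb
    have h1 := (Finset.mem_image.1 hb).choose_spec.2
    generalize_proofs _ h2
    exact ((h _ _).2 h2.choose_spec.2).trans h1
  · intro c hc
    have h1 := (Finset.mem_image.1 hc).choose_spec.2
    generalize_proofs _ h2
    exact ((h _ _).1 h2.choose_spec.2).trans h1

/-- The set partition of `[n]` into the fibres of `f`. -/
theorem exists_setPart_restrictCard {n : ℕ} {β : Type*} [DecidableEq β] (f : Fin n → β) :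
    ∃ σ : SetPart n, ∀ S, restrictCard σ S = (S.image f).card := by
  classical
  refine ⟨Finpartition.ofSetoid (Setoid.ker f), fun S => ?_⟩
  rw [restrictCard_eq_card_image]
  refine card_image_eq_of_eq_iff (fun i j => ?_) S
  rw [← Finpartition.mem_part_iff_part_eq_part _ (Finset.mem_univ i) (Finset.mem_univ j),
    Finpartition.mem_part_ofSetoid_iff_rel]
  exact ⟨fun h => h.symm, fun h => h.symm⟩

/-! ### Inclusion–exclusion and inversion over subsets -/

/-- If colours are independently 1 with probability `x`, both sides are the probability that the
colours of `T` are 0 and those in `B` are 1. The set `B` is there for the induction: it absorbs the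
colour of the inserted point. -/
theorem sum_powerset_neg_one_pow_mul_pow_card_image_union {α β R : Type*} [DecidableEq α]
    [DecidableEq β] [CommRing R] (f : α → β) (x : R) (T : Finset α) (B : Finset β) :
    ∑ S ∈ T.powerset, (-1) ^ S.card * x ^ (S.image f ∪ B).card =
      if Disjoint (T.image f) B then x ^ B.card * (1 - x) ^ (T.image f).card else 0 := by
  induction T using Finset.induction_on generalizing B with
  | empty => simp
  | insert a T ha ih =>
    rw [Finset.sum_powerset_insert ha, ih B]
    have h : ∀ S ∈ T.powerset, (-1 : R) ^ (insert a S).card * x ^ ((insert a S).image f ∪ B).card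
        = - ((-1) ^ S.card * x ^ (S.image f ∪ insert (f a) B).card) := by
      intro S hS
      rw [Finset.card_insert_of_notMem fun h => ha (Finset.mem_powerset.1 hS h),
        Finset.image_insert, Finset.insert_union, Finset.union_insert]
      ring
    rw [Finset.sum_congr rfl h, Finset.sum_neg_distrib, ih, Finset.image_insert]
    by_cases haB : f a ∈ B
    · simp [haB]
    by_cases hd : Disjoint (T.image f) B
    · by_cases haT : f a ∈ T.image f
      · rw [Finset.insert_eq_of_mem haT, if_pos hd,
          if_neg (fun h => Finset.disjoint_left.1 h haT (Finset.mem_insert_self _ _))]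
        simp
      · rw [if_pos hd, if_pos (Finset.disjoint_insert_right.2 ⟨haT, hd⟩),
          if_pos (Finset.disjoint_insert_left.2 ⟨haB, hd⟩), Finset.card_insert_of_notMem haB,
          Finset.card_insert_of_notMem haT]
        ring
    · rw [if_neg hd, if_neg (fun h => hd (Finset.disjoint_insert_right.1 h).2),
        if_neg (fun h => hd (Finset.disjoint_insert_left.1 h).2)]
      simp

theorem sum_powerset_neg_one_pow_mul_pow_restrictCard {n : ℕ} (σ : SetPart n) (x : ℝ)
    (T : Finset (Fin n)) :
    ∑ S ∈ T.powerset, (-1) ^ S.card * x ^ restrictCard σ S = (1 - x) ^ restrictCard σ T := by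
  simpa [restrictCard_eq_card_image] using
    sum_powerset_neg_one_pow_mul_pow_card_image_union σ.part x T ∅

/-- The two kernels are tensor powers of the mutually inverse unipotent 2×2 matrices with
off-diagonal entries `x` and `-x`. -/
theorem sum_powerset_pow_mul_sum_powerset_neg_pow {α R : Type*} [DecidableEq α] [CommRing R]
    (x : R) (d : Finset α → R) (S : Finset α) :
    ∑ T ∈ S.powerset, x ^ (S \ T).card * ∑ U ∈ T.powerset, (-x) ^ (T \ U).card * d U = d S := by
  have step : ∀ (z : R) (e : Finset α → R) (a : α) (S : Finset α), a ∉ S →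
      ∑ T ∈ (insert a S).powerset, z ^ (insert a S \ T).card * e T =
        z * ∑ T ∈ S.powerset, z ^ (S \ T).card * e T +
          ∑ T ∈ S.powerset, z ^ (S \ T).card * e (insert a T) := by
    intro z e a S ha
    rw [Finset.sum_powerset_insert ha, Finset.mul_sum]
    congr 1
    · refine Finset.sum_congr rfl fun T hT => ?_
      have haT : a ∉ T := fun h => ha (Finset.mem_powerset.1 hT h)
      rw [Finset.insert_sdiff_of_notMem _ haT, Finset.card_insert_of_notMem (by simp [ha])]
      ring
    · refine Finset.sum_congr rfl fun T _ => ?_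
      rw [Finset.insert_sdiff_insert, Finset.sdiff_insert_of_notMem ha]
  induction S using Finset.induction_on generalizing d with
  | empty => simp
  | insert a S ha ih =>
    rw [step _ _ _ _ ha, ih]
    have h : ∀ T ∈ S.powerset, x ^ (S \ T).card *
        ∑ U ∈ (insert a T).powerset, (-x) ^ (insert a T \ U).card * d U =
        -x * (x ^ (S \ T).card * ∑ U ∈ T.powerset, (-x) ^ (T \ U).card * d U) +
        x ^ (S \ T).card * ∑ U ∈ T.powerset, (-x) ^ (T \ U).card * d (insert a U) := by
      intro T hT
      rw [step _ _ _ _ fun h => ha (Finset.mem_powerset.1 hT h)]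
      ring
    rw [Finset.sum_congr rfl h, Finset.sum_add_distrib, ← Finset.mul_sum, ih,
      ih (fun U => d (insert a U))]
    ring

/-- Once `v` vanishes on proper subsets, only `S = T` survives. If `(-1) ^ |T| = -ε`, the relation
reads `ε v T = -ε v T`; the other parity is assumed. -/
theorem eq_zero_of_mul_eq_sum_powerset_neg_one_pow {α : Type*} [DecidableEq α]
    {ε : ℝ} (hε : ε = 1 ∨ ε = -1) {v : Finset α → ℝ}
    (h : ∀ T, ε * v T = ∑ S ∈ T.powerset, (-1) ^ S.card * v S)
    (h0 : ∀ T, (-1 : ℝ) ^ T.card = ε → v T = 0) (T : Finset α) : v T = 0 := by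
  induction T using Finset.strongInduction with
  | H T ih =>
    by_cases hT : (-1 : ℝ) ^ T.card = ε
    · exact h0 T hT
    have h1 := h T
    rw [← Finset.insert_erase (Finset.mem_powerset_self T),
      Finset.sum_insert (Finset.notMem_erase _ _), Finset.sum_eq_zero, add_zero] at h1
    · rcases hε with rfl | rfl <;> rcases neg_one_pow_eq_or ℝ T.card with h2 | h2 <;>
        rw [h2] at h1 hT <;> first | exact absurd rfl hT | linarith
    · intro S hS
      obtain ⟨hne, hS⟩ := Finset.mem_erase.1 hS
      rw [ih S ((Finset.mem_powerset.1 hS).ssubset_of_ne hne), mul_zero]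

/-! ### Signed combinations of partitions supported above a given set -/

section ColorFunctions

open Finset

variable {n : ℕ}

/-- The function `(p, S) ↦ p ^ ‖σ_S‖`, where `σ` is the partition of `[n]` into fibres of `f`. -/
def colorFun (f : Fin n → Fin n) : Set.Ioo (0 : ℝ) 1 → Finset (Fin n) → ℝ :=
  fun p S => (p : ℝ) ^ (S.image f).card

/-- The span of the functions `colorFun f` over all `f` whose fibres outside `T` are singletons. -/
def colorSpan (T : Finset (Fin n)) : Submodule ℝ (Set.Ioo (0 : ℝ) 1 → Finset (Fin n) → ℝ) :=
  Submodule.span ℝ (colorFun '' {f | ∀ i ∉ T, ∀ j, f j = f i → j = i})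

theorem colorSpan_mono {T U : Finset (Fin n)} (h : T ⊆ U) : colorSpan T ≤ colorSpan U :=
  Submodule.span_mono (Set.image_mono fun _ hf i hi => hf i fun hT => hi (h hT))

/-- Merging the singleton `b` into the fibre of `a`. -/
theorem colorFun_update (f : Fin n → Fin n) {a b : Fin n} (hab : a ≠ b)
    (hb : ∀ j, f j = f b → j = b) (p : Set.Ioo (0 : ℝ) 1) (S : Finset (Fin n)) :
    colorFun (Function.update f b (f a)) p S =
      if b ∈ S ∧ ∃ i ∈ S, f i = f a then (p : ℝ)⁻¹ * colorFun f p S else colorFun f p S := by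
  have hp : (p : ℝ) ≠ 0 := p.2.1.ne'
  unfold colorFun
  by_cases hbS : b ∈ S
  · obtain ⟨U, hbU, rfl⟩ : ∃ U, b ∉ U ∧ insert b U = S :=
      ⟨S.erase b, notMem_erase _ _, insert_erase hbS⟩
    have h1 : U.image (Function.update f b (f a)) = U.image f :=
      image_congr fun i hi => Function.update_of_ne (fun h => hbU (by subst h; exact hi)) _ _
    have h2 : f b ∉ U.image f := fun h => by
      obtain ⟨i, hi, hfi⟩ := mem_image.1 h
      exact hbU (hb i hfi ▸ hi)
    have h3 : (∃ i ∈ insert b U, f i = f a) ↔ f a ∈ U.image f := by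
      simp only [mem_insert, mem_image, exists_eq_or_imp, or_iff_right_iff_imp]
      exact fun h => absurd (hb a h.symm) hab
    simp only [hbS, true_and, h3]
    rw [image_insert, image_insert, h1, Function.update_self, card_insert_of_notMem h2]
    split_ifs with h
    · rw [insert_eq_of_mem h, pow_succ]
      field_simp
    · rw [card_insert_of_notMem h]
  · have h1 : S.image (Function.update f b (f a)) = S.image f :=
      image_congr fun i hi => Function.update_of_ne (fun h => hbS (by subst h; exact hi)) _ _
    rw [if_neg fun h => hbS h.1, h1]

/-- In every generator of `colorSpan T` the points `a` and `b` are singletons, so merging them loses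
one colour exactly when `S` contains both. -/
theorem mul_merge_mem_colorSpan {T : Finset (Fin n)} {a b : Fin n} (ha : a ∉ T) (hb : b ∉ T)
    (hab : a ≠ b) {g : Set.Ioo (0 : ℝ) 1 → Finset (Fin n) → ℝ} (hg : g ∈ colorSpan T) :
    (fun (p : Set.Ioo (0 : ℝ) 1) S => (if a ∈ S ∧ b ∈ S then (p : ℝ)⁻¹ else 1) * g p S) ∈
      colorSpan (insert a (insert b T)) := by
  let m : Set.Ioo (0 : ℝ) 1 → Finset (Fin n) → ℝ :=
    fun p S => if a ∈ S ∧ b ∈ S then (p : ℝ)⁻¹ else 1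
  suffices h : (colorSpan T).map (LinearMap.mulLeft ℝ m) ≤ colorSpan (insert a (insert b T)) from
    h (Submodule.mem_map_of_mem hg)
  refine (Submodule.map_span_le _ _ _).2 ?_
  rintro _ ⟨f, hf, rfl⟩
  refine Submodule.subset_span ⟨Function.update f b (f a), fun i hi j hj => ?_, ?_⟩
  · simp only [mem_insert, not_or] at hi
    rw [Function.update_of_ne hi.2.1] at hj
    by_cases hjb : j = b
    · subst hjb
      rw [Function.update_self] at hj
      exact absurd (hf i hi.2.2 a hj).symm hi.1
    · rw [Function.update_of_ne hjb] at hj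
      exact hf i hi.2.2 j hj
  · funext p S
    rw [colorFun_update f hab (hf b hb)]
    have : (∃ i ∈ S, f i = f a) ↔ a ∈ S :=
      ⟨fun ⟨i, hi, h⟩ => hf a ha i h ▸ hi, fun h => ⟨a, h, rfl⟩⟩
    simp only [this, LinearMap.mulLeft_apply, Pi.mul_apply, m, and_comm (a := b ∈ S)]
    split_ifs <;> simp

/-- The weight `(p (1 - p)) ^ ⌊m / 2⌋ (2 p - 1) ^ (m mod 2)`. -/
def topWeight (m : ℕ) (p : ℝ) : ℝ := (p * (1 - p)) ^ (m / 2) * (2 * p - 1) ^ (m % 2)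

theorem colorFun_id (p : Set.Ioo (0 : ℝ) 1) (S : Finset (Fin n)) :
    colorFun id p S = (p : ℝ) ^ S.card := by
  simp [colorFun]

theorem colorFun_id_mem (T : Finset (Fin n)) : colorFun id ∈ colorSpan T :=
  Submodule.subset_span ⟨id, fun _ _ _ h => h, rfl⟩

theorem triple_mem_colorSpan {a b c : Fin n} (hab : a ≠ b) (hac : a ≠ c) (hbc : b ≠ c) :
    (fun p S => if {a, b, c} ⊆ S then
      (p : ℝ) ^ (S \ {a, b, c}).card * topWeight 3 p else 0 :
        Set.Ioo (0 : ℝ) 1 → Finset (Fin n) → ℝ) ∈ colorSpan {a, b, c} := by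
  have key : ∀ x y : Fin n, x ≠ y → x ∈ ({a, b, c} : Finset (Fin n)) →
      y ∈ ({a, b, c} : Finset (Fin n)) →
      (fun (p : Set.Ioo (0 : ℝ) 1) S => (if x ∈ S ∧ y ∈ S then (p : ℝ)⁻¹ else 1) * colorFun id p S) ∈
        colorSpan ({a, b, c} : Finset (Fin n)) := fun x y hxy hx hy =>
    colorSpan_mono (by simp [insert_subset_iff, hx, hy])
      (mul_merge_mem_colorSpan (notMem_empty x) (notMem_empty y) hxy (colorFun_id_mem ∅))
  have hA := key a b hab (by simp) (by simp)
  have hB := key a c hac (by simp) (by simp)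
  have hC := key b c hbc (by simp) (by simp)
  have hD : colorFun (Function.update (Function.update id b a) c a) ∈
      colorSpan ({a, b, c} : Finset (Fin n)) := by
    refine Submodule.subset_span ⟨_, fun i hi j hj => ?_, rfl⟩
    simp only [mem_insert, mem_singleton, not_or] at hi
    simp only [Function.update_apply, id, hi.2.1, hi.2.2, if_false] at hj
    split_ifs at hj
    · exact absurd hj.symm hi.1
    · exact absurd hj.symm hi.1
    · exact hj
  -- The three pair merges, minus the full merge, minus twice the singletons: a negated third
  -- cumulant. On the triple it is `3p² - p - 2p³ = p(1 - p)(2p - 1)`, and it cancels on smaller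
  -- traces.
  have hsum := Submodule.sub_mem _ (Submodule.sub_mem _ (Submodule.add_mem _ (Submodule.add_mem _
    hA hB) hC) hD) (Submodule.smul_mem _ (2 : ℝ) (colorFun_id_mem {a, b, c}))
  convert hsum using 1
  funext p S
  have hp : (p : ℝ) ≠ 0 := p.2.1.ne'
  have h1 : colorFun (Function.update id b a) p S =
      (if a ∈ S ∧ b ∈ S then (p : ℝ)⁻¹ else 1) * colorFun id p S := by
    have := colorFun_update id hab (fun j h => h) p S
    simp only [id, exists_eq_right, and_comm (a := b ∈ S)] at this
    rw [this]
    split_ifs <;> simp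
  have h2 := colorFun_update (Function.update id b a) hac (fun j h => by
    simp only [Function.update_apply, id, hbc.symm, if_false] at h
    split_ifs at h
    · exact absurd h hac
    · exact h) p S
  have h3 : (∃ i ∈ S, Function.update id b a i = Function.update id b a a) ↔ a ∈ S ∨ b ∈ S := by
    rw [Function.update_of_ne hab]
    constructor
    · rintro ⟨i, hi, h⟩
      by_cases hib : i = b
      · exact Or.inr (hib ▸ hi)
      · rw [Function.update_of_ne hib] at h
        exact Or.inl (by rw [← show i = a from h]; exact hi)
    · rintro (h | h)
      · exact ⟨a, h, by rw [Function.update_of_ne hab]⟩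
      · exact ⟨b, h, by simp⟩
  rw [Function.update_of_ne hab, id, h1] at h2
  rw [Function.update_of_ne hab, id] at h3
  simp only [h3] at h2
  simp only [Pi.smul_apply, Pi.sub_apply, Pi.add_apply, smul_eq_mul, h2, colorFun_id]
  by_cases ha : a ∈ S <;> by_cases hb : b ∈ S <;> by_cases hc : c ∈ S <;>
    simp only [insert_subset_iff, singleton_subset_iff, ha, hb, hc, and_self, and_true, and_false,
      or_true, or_false, if_true, if_false] <;> try ring1
  have h4 : S.card = (S \ {a, b, c}).card + 3 := by
    rw [← card_sdiff_add_card_eq_card (s := {a, b, c}) (t := S)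
      (by simp [insert_subset_iff, ha, hb, hc]), card_eq_three.2 ⟨a, b, c, hab, hac, hbc, rfl⟩]
  rw [h4, topWeight, pow_add]
  field_simp
  ring

theorem topWeight_mem_colorSpan (T : Finset (Fin n)) (hT : T.card ≠ 1) :
    (fun p S => if T ⊆ S then (p : ℝ) ^ (S \ T).card * topWeight T.card p else 0 :
        Set.Ioo (0 : ℝ) 1 → Finset (Fin n) → ℝ) ∈ colorSpan T := by
  induction hm : T.card using Nat.strong_induction_on generalizing T with
  | _ m ih =>
  subst hm
  rcases Nat.eq_zero_or_pos T.card with h0 | h0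
  · obtain rfl := card_eq_zero.1 h0
    convert colorFun_id_mem (∅ : Finset (Fin n)) using 1
    funext p S
    simp [colorFun_id, topWeight]
  -- The induction removes two points at a time, so size 3 needs its own base: it would descend to
  -- the excluded size 1.
  by_cases h3 : T.card = 3
  · obtain ⟨a, b, c, hab, hac, hbc, rfl⟩ := card_eq_three.1 h3
    rw [h3]
    exact triple_mem_colorSpan hab hac hbc
  obtain ⟨a, ha, b, hb, hab⟩ := one_lt_card.1 (show 1 < T.card by omega)
  obtain ⟨U, haU, hbU, rfl⟩ : ∃ U, a ∉ U ∧ b ∉ U ∧ insert a (insert b U) = T :=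
    ⟨(T.erase a).erase b, by simp, by simp, by
      rw [insert_erase (mem_erase.2 ⟨hab.symm, hb⟩), insert_erase ha]⟩
  have hcard : (insert a (insert b U)).card = U.card + 2 := by
    rw [card_insert_of_notMem (by simp [hab, haU]), card_insert_of_notMem hbU]
  rw [hcard] at ih ⊢
  have hU := ih U.card (by omega) U (by omega) rfl
  -- Merged minus unmerged is a factor `p⁻¹ - 1 = p⁻² * (p (1 - p))` when `a, b ∈ S`, and zero
  -- otherwise.
  have hsub := Submodule.sub_mem _ (mul_merge_mem_colorSpan haU hbU hab hU)
    (colorSpan_mono (fun i hi => by simp [hi]) hU)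
  convert hsub using 1
  funext p S
  have hp : (p : ℝ) ≠ 0 := p.2.1.ne'
  simp only [Pi.sub_apply, insert_subset_iff]
  by_cases hUS : U ⊆ S
  · by_cases haS : a ∈ S <;> by_cases hbS : b ∈ S <;>
      simp only [hUS, haS, hbS, and_self, and_true, and_false, if_true, if_false] <;>
      try ring1
    have h4 : (S \ U).card = (S \ insert a (insert b U)).card + 2 := by
      have h5 := card_sdiff_add_card_eq_card hUS
      have h6 := card_sdiff_add_card_eq_card (s := insert a (insert b U)) (t := S)
        (by simp [insert_subset_iff, haS, hbS, hUS])
      omega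
    rw [h4, topWeight, topWeight, show (U.card + 2) / 2 = U.card / 2 + 1 by omega,
      show (U.card + 2) % 2 = U.card % 2 by omega, pow_add]
    field_simp
    ring
  · simp [hUS]

/-- One `q` serves all `p` because the span is taken among functions of `p` and `S` jointly. Size 1
is impossible: every partition has transform 1 at `∅` and `p` at `{i}`, so a combination vanishing
at `∅` vanishes at `{i}`. -/
theorem exists_signed_setPart (T : Finset (Fin n)) (hT : T.card ≠ 1) :
    ∃ q : SetPart n → ℝ, ∀ p ∈ Set.Ioo (0 : ℝ) 1, ∀ S,
      ∑ σ, p ^ restrictCard σ S * q σ =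
        if T ⊆ S then p ^ (S \ T).card * topWeight T.card p else 0 := by
  have h := topWeight_mem_colorSpan T hT
  have hle : colorSpan T ≤ Submodule.span ℝ (Set.range
      (fun (σ : SetPart n) (p : Set.Ioo (0 : ℝ) 1) S => (p : ℝ) ^ restrictCard σ S)) := by
    refine Submodule.span_mono ?_
    rintro _ ⟨f, -, rfl⟩
    obtain ⟨σ, hσ⟩ := exists_setPart_restrictCard f
    exact ⟨σ, by funext p S; simp [colorFun, hσ]⟩
  obtain ⟨q, hq⟩ := (Submodule.mem_span_range_iff_exists_fun ℝ).1 (hle h)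
  refine ⟨q, fun p hp S => ?_⟩
  have := congrFun (congrFun hq ⟨p, hp⟩) S
  simpa [Finset.sum_apply, mul_comm] using this

theorem topWeight_ne_zero {m : ℕ} {p : ℝ} (hp : p ∈ Set.Ioo (0 : ℝ) 1) (hp2 : p ≠ 1 / 2) :
    topWeight m p ≠ 0 := by
  refine mul_ne_zero (pow_ne_zero _ (mul_ne_zero hp.1.ne' (by linarith [hp.2]))) (pow_ne_zero _ ?_)
  intro h
  exact hp2 (by linarith)

end ColorFunctions

/-! ### Cylinder events, defects and the reflection of `p` about `1/2` -/

theorem measureReal_zeroOneEvent {n : ℕ} (μ : Measure (Fin n → Fin 2)) [IsFiniteMeasure μ]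
    (T B : Finset (Fin n)) :
    μ.real (zeroOneEvent T B) =
      ∑ S ∈ T.powerset, (-1) ^ S.card * μ.real (onesEvent (S ∪ B)) := by
  induction T using Finset.induction_on generalizing B with
  | empty => simp [zeroOneEvent, onesEvent]
  | insert a T ha ih =>
    have hdiff : zeroOneEvent (insert a T) B = zeroOneEvent T B \ zeroOneEvent T (insert a B) := by
      ext ρ
      have h01 : ρ a = 0 ↔ ¬ ρ a = 1 := by omega
      simp only [zeroOneEvent, Set.mem_ofPred_eq, Set.mem_sdiff, Finset.forall_mem_insert, h01]
      tauto
    have hsub : zeroOneEvent T (insert a B) ⊆ zeroOneEvent T B := fun ρ h =>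
      ⟨h.1, fun i hi => h.2 i (Finset.mem_insert_of_mem hi)⟩
    rw [hdiff, measureReal_sdiff hsub (Set.toFinite _).measurableSet, ih, ih,
      Finset.sum_powerset_insert ha, sub_eq_add_neg, ← Finset.sum_neg_distrib]
    congr 1
    refine Finset.sum_congr rfl fun S hS => ?_
    rw [Finset.card_insert_of_notMem fun h => ha (Finset.mem_powerset.1 hS h),
      Finset.insert_union, Finset.union_insert]
    ring

theorem measureReal_onesEvent_singleton {n : ℕ} {μ : Measure (Fin n → Fin 2)} {p : ℝ}
    (hp : 0 ≤ p) (hμ : HasBernoulliMarginals μ p) (i : Fin n) :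
    μ.real (onesEvent {i}) = p := by
  have h : onesEvent {i} = (fun ρ : Fin n → Fin 2 => ρ i) ⁻¹' {1} := by
    ext ρ
    simp [onesEvent]
  rw [measureReal_def, h, ← Measure.map_apply (measurable_pi_apply i) (measurableSet_singleton _),
    hμ i]
  simp [hp]

theorem onesEvent_one_sub {n : ℕ} {μ μ' : Measure (Fin n → Fin 2)} [IsFiniteMeasure μ]
    (T : Finset (Fin n)) (h : μ (zeroOneEvent T ∅) = μ' (zeroOneEvent ∅ T)) :
    μ'.real (onesEvent T) = ∑ S ∈ T.powerset, (-1) ^ S.card * μ.real (onesEvent S) := by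
  have h1 : onesEvent T = zeroOneEvent ∅ T := by simp [zeroOneEvent, onesEvent]
  rw [h1, measureReal_def, ← h, ← measureReal_def, measureReal_zeroOneEvent]
  simp

theorem HasDerivAt.tendsto_sub_reflect_div {g : ℝ → ℝ} {g' : ℝ} (hg : HasDerivAt g g' (1 / 2)) :
    Tendsto (fun p => (g p - g (1 - p)) / (2 * p - 1)) (𝓝[≠] (1 / 2)) (𝓝 g') := by
  have h1 : HasDerivAt (fun p => g (1 - p)) (-g') (1 / 2) := by
    have : HasDerivAt g g' (1 - 1 / 2) := by norm_num at hg ⊢; exact hg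
    simpa using this.comp_const_sub 1 (1 / 2)
  have h2 := ((hg.sub h1).tendsto_slope).const_mul (1 / 2)
  have h3 : 1 / 2 * (g' - -g') = g' := by ring
  rw [h3] at h2
  refine h2.congr' ?_
  filter_upwards [self_mem_nhdsWithin] with p hp
  have hp1 : p - 1 / 2 ≠ 0 := sub_ne_zero.2 hp
  have hp2 : 2 * p - 1 ≠ 0 := fun h => hp1 (by linarith)
  have h4 : g (1 - 1 / 2) = g (1 / 2) := by norm_num
  simp only [slope, vsub_eq_sub, smul_eq_mul, Pi.sub_apply, h4, sub_self, sub_zero]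
  rw [inv_mul_eq_div, one_div, ← div_eq_inv_mul, div_div]
  congr 1
  ring

theorem half_pow_eq (k : ℕ) : (1 / 2 : ℝ) ^ k = 2 ^ (-(k : ℤ)) := by
  simp [zpow_neg]

/-- At `k = 0` the truncated exponent is harmless, since the factor `k` vanishes. -/
theorem mul_half_pow_eq (k : ℕ) :
    (k : ℝ) * (1 / 2 : ℝ) ^ (k - 1) = k * 2 ^ (-(k : ℤ) + 1) := by
  rcases k with _ | k
  · simp
  · rw [Nat.add_sub_cancel, half_pow_eq]
    congr 2
    push_cast
    ring

/-- The defect of `q` in the equation of a formal solution indexed by `S`. -/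
noncomputable def formalDefect {n : ℕ} (μ : Measure (Fin n → Fin 2)) (q : SetPart n → ℝ) (p : ℝ)
    (S : Finset (Fin n)) : ℝ :=
  μ.real (onesEvent S) - ∑ σ, p ^ restrictCard σ S * q σ

theorem formalDefect_one_sub {n : ℕ} {μ μ' : Measure (Fin n → Fin 2)} [IsFiniteMeasure μ]
    (q : SetPart n → ℝ) (p : ℝ) (T : Finset (Fin n))
    (h : μ (zeroOneEvent T ∅) = μ' (zeroOneEvent ∅ T)) :
    formalDefect μ' q (1 - p) T = ∑ S ∈ T.powerset, (-1) ^ S.card * formalDefect μ q p S := by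
  simp only [formalDefect, mul_sub, Finset.sum_sub_distrib]
  rw [onesEvent_one_sub T h]
  congr 1
  simp_rw [Finset.mul_sum]
  rw [Finset.sum_comm]
  refine Finset.sum_congr rfl fun σ _ => ?_
  rw [← sum_powerset_neg_one_pow_mul_pow_restrictCard, Finset.sum_mul]
  exact Finset.sum_congr rfl fun S _ => by ring

theorem isFormalSolution_iff_formalDefect {n : ℕ} {μ : Measure (Fin n → Fin 2)} {p : ℝ}
    {q : SetPart n → ℝ} : IsFormalSolution μ p q ↔ ∀ S, formalDefect μ q p S = 0 :=
  forall_congr' fun _ => by rw [formalDefect, sub_eq_zero, eq_comm]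

theorem hasDerivAt_sum_pow_restrictCard {n : ℕ} (q : SetPart n → ℝ) (S : Finset (Fin n)) :
    HasDerivAt (fun p : ℝ => ∑ σ, p ^ restrictCard σ S * q σ)
      (∑ σ, (restrictCard σ S : ℝ) * (2 : ℝ) ^ (-(restrictCard σ S : ℤ) + 1) * q σ) (1 / 2) := by
  refine HasDerivAt.fun_sum fun σ _ => ?_
  rw [← mul_half_pow_eq]
  exact (hasDerivAt_pow _ _).mul_const _

/-- The value at `1/2` is fixed by the reflection and the derivative changes sign, so
`eq_zero_of_mul_eq_sum_powerset_neg_one_pow` applies with `ε = 1` and `ε = -1` respectively. -/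
theorem eq_zero_and_deriv_eq_zero_of_reflect {n : ℕ} {d : ℝ → Finset (Fin n) → ℝ} {D : Finset (Fin n) → ℝ}
    (hD : ∀ S, HasDerivAt (fun p => d p S) (D S) (1 / 2))
    (hflip : ∀ p ∈ Set.Ioo (0 : ℝ) 1, ∀ T,
      d (1 - p) T = ∑ S ∈ T.powerset, (-1) ^ S.card * d p S)
    (heven : ∀ S, Even S.card → d (1 / 2) S = 0) (hodd : ∀ S, Odd S.card → D S = 0)
    (T : Finset (Fin n)) : d (1 / 2) T = 0 ∧ D T = 0 := by
  have hhalf : (1 / 2 : ℝ) ∈ Set.Ioo (0 : ℝ) 1 := by norm_num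
  constructor
  · refine eq_zero_of_mul_eq_sum_powerset_neg_one_pow (Or.inl rfl) (fun T => ?_)
      (fun T hT => heven T ?_) T
    · have := hflip _ hhalf T
      rw [show (1 : ℝ) - 1 / 2 = 1 / 2 by norm_num] at this
      rw [one_mul, this]
    · exact (neg_one_pow_eq_one_iff_even (by norm_num)).1 hT
  · refine eq_zero_of_mul_eq_sum_powerset_neg_one_pow (Or.inr rfl) (fun T => ?_)
      (fun T hT => hodd T ?_) T
    · have h1 : HasDerivAt (fun p => d (1 - p) T) (-D T) (1 / 2) := by
        have : HasDerivAt (fun p => d p T) (D T) (1 - 1 / 2) := by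
          rw [show (1 : ℝ) - 1 / 2 = 1 / 2 by norm_num]
          exact hD T
        simpa using this.comp_const_sub 1 (1 / 2)
      have h2 : HasDerivAt (fun p => ∑ S ∈ T.powerset, (-1) ^ S.card * d p S)
          (∑ S ∈ T.powerset, (-1) ^ S.card * D S) (1 / 2) :=
        HasDerivAt.fun_sum fun S _ => (hD S).const_mul _
      rw [neg_one_mul]
      refine h1.unique (h2.congr_of_eventuallyEq ?_)
      filter_upwards [Ioo_mem_nhds hhalf.1 hhalf.2] with p hp using hflip p hp T
    · by_contra hne
      rw [Nat.not_odd_iff_even] at hne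
      rw [hne.neg_one_pow] at hT
      norm_num at hT

/-! ### Correcting the defect -/

theorem tendsto_div_topWeight {y : ℝ → ℝ} (hy0 : y (1 / 2) = 0) (hy : HasDerivAt y 0 (1 / 2))
    (m : ℕ) : Tendsto (fun p => y p / topWeight m p) (𝓝[≠] (1 / 2)) (𝓝 0) := by
  have h0 : Tendsto (fun p : ℝ => ((p * (1 - p)) ^ (m / 2))⁻¹) (𝓝[≠] (1 / 2))
      (𝓝 ((1 / 2 * (1 - 1 / 2)) ^ (m / 2))⁻¹) := by
    refine Tendsto.inv₀ (tendsto_nhdsWithin_of_tendsto_nhds ?_) (by norm_num)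
    exact Continuous.tendsto (by fun_prop) _
  have h1 : Tendsto (fun p => y p / (2 * p - 1) ^ (m % 2)) (𝓝[≠] (1 / 2)) (𝓝 0) := by
    rcases Nat.mod_two_eq_zero_or_one m with h | h
    · simp only [h, pow_zero, div_one]
      have h2 := hy.continuousAt.tendsto
      rw [hy0] at h2
      exact tendsto_nhdsWithin_of_tendsto_nhds h2
    · have h2 := hy.tendsto_slope.const_mul (1 / 2)
      rw [mul_zero] at h2
      refine h2.congr' ?_
      filter_upwards [self_mem_nhdsWithin] with p hp
      have hp1 : p - 1 / 2 ≠ 0 := sub_ne_zero.2 hp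
      have hp2 : 2 * p - 1 ≠ 0 := fun h => hp1 (by linarith)
      simp only [slope, vsub_eq_sub, smul_eq_mul, hy0, sub_zero, h, pow_one]
      rw [inv_mul_eq_div, one_div, ← div_eq_inv_mul, div_div]
      congr 1
      ring
  have h3 := h0.mul h1
  rw [mul_zero] at h3
  refine h3.congr fun p => ?_
  rw [topWeight, div_mul_eq_div_div_swap, div_eq_inv_mul (_ / _)]

/-- The coefficient of the signed partition attached to `T` in the correction of the defect `d`. -/
noncomputable def correctionCoeff {n : ℕ} (p : ℝ) (d : Finset (Fin n) → ℝ) (T : Finset (Fin n)) :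
    ℝ :=
  ∑ U ∈ T.powerset, (-p) ^ (T \ U).card * d U

theorem correctionCoeff_eq_zero {n : ℕ} {p : ℝ} {d : Finset (Fin n) → ℝ}
    (hd : ∀ i, d {i} = p * d ∅) {T : Finset (Fin n)} (hT : T.card = 1) :
    correctionCoeff p d T = 0 := by
  obtain ⟨i, rfl⟩ := Finset.card_eq_one.1 hT
  have h : ({i} : Finset (Fin n)).powerset = {∅, {i}} := by
    ext U
    simp [Finset.subset_singleton_iff]
  rw [correctionCoeff, h, Finset.sum_pair (Finset.singleton_ne_empty i).symm, hd]
  simp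

/-- Dividing by `topWeight` normalises the transform of `r T` to `p ^ |S \ T|`, the kernel inverted
by `correctionCoeff`. At singletons `r T` is arbitrary, as its coefficient is zero. -/
theorem sum_correction {n : ℕ} {p : ℝ} (hp : p ∈ Set.Ioo (0 : ℝ) 1) (hp2 : p ≠ 1 / 2)
    {d : Finset (Fin n) → ℝ} (hd : ∀ i, d {i} = p * d ∅)
    {r : Finset (Fin n) → SetPart n → ℝ}
    (hr : ∀ T, T.card ≠ 1 → ∀ S, ∑ σ, p ^ restrictCard σ S * r T σ =
        if T ⊆ S then p ^ (S \ T).card * topWeight T.card p else 0)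
    (S : Finset (Fin n)) :
    ∑ σ, p ^ restrictCard σ S * ∑ T, correctionCoeff p d T / topWeight T.card p * r T σ = d S := by
  simp_rw [Finset.mul_sum]
  rw [Finset.sum_comm]
  have h : ∀ T ∈ Finset.univ, ∑ σ, p ^ restrictCard σ S *
      (correctionCoeff p d T / topWeight T.card p * r T σ) =
      if T ⊆ S then p ^ (S \ T).card * correctionCoeff p d T else 0 := by
    intro T _
    by_cases hT : T.card = 1
    · simp [correctionCoeff_eq_zero hd hT]
    · have h1 : ∀ σ, p ^ restrictCard σ S * (correctionCoeff p d T / topWeight T.card p * r T σ) =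
          correctionCoeff p d T / topWeight T.card p * (p ^ restrictCard σ S * r T σ) :=
        fun σ => by ring
      simp_rw [h1]
      rw [← Finset.mul_sum, hr T hT]
      have := topWeight_ne_zero (m := T.card) hp hp2
      split_ifs
      · field_simp
      · simp
  rw [Finset.sum_congr rfl h, ← Finset.sum_filter]
  have h2 : Finset.univ.filter (fun T => T ⊆ S) = S.powerset := by
    ext T
    simp
  rw [h2]
  exact sum_powerset_pow_mul_sum_powerset_neg_pow p d S

theorem hasDerivAt_correctionCoeff {n : ℕ} {d : ℝ → Finset (Fin n) → ℝ}
    (hd0 : ∀ S, d (1 / 2) S = 0) (hd : ∀ S, HasDerivAt (fun p => d p S) 0 (1 / 2))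
    (T : Finset (Fin n)) : HasDerivAt (fun p => correctionCoeff p (d p) T) 0 (1 / 2) := by
  have h : HasDerivAt (fun p => correctionCoeff p (d p) T) (∑ U ∈ T.powerset, (0 : ℝ)) (1 / 2) := by
    refine HasDerivAt.fun_sum fun U _ => ?_
    have h1 : HasDerivAt (fun p : ℝ => (-p) ^ (T \ U).card) _ (1 / 2) :=
      (hasDerivAt_neg (1 / 2 : ℝ)).pow (T \ U).card
    have h2 := h1.fun_mul (hd U)
    rwa [hd0 U, mul_zero, mul_zero, add_zero] at h2
  simpa using h

theorem exists_seq_tendsto_half : ∃ u : ℕ → ℝ, (∀ k, u k ∈ Set.Ioo (0 : ℝ) 1 ∧ u k ≠ 1 / 2) ∧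
    Tendsto u atTop (𝓝 (1 / 2)) := by
  obtain ⟨u, -, hu, hlim⟩ := exists_seq_strictAnti_tendsto' (show (1 / 2 : ℝ) < 1 by norm_num)
  exact ⟨u, fun k => ⟨⟨by linarith [(hu k).1], (hu k).2⟩, (hu k).1.ne'⟩, hlim⟩

/-! ### The two inclusions -/

theorem theorem1p5 (n : ℕ) (ν : ℝ → Measure (Fin n → Fin 2))
    (hprob : ∀ p ∈ Set.Ioo (0 : ℝ) 1, IsProbabilityMeasure (ν p))
    (hmarg : ∀ p ∈ Set.Ioo (0 : ℝ) 1, HasBernoulliMarginals (ν p) p)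
    (hdiff : ∀ S : Finset (Fin n),
      DifferentiableAt ℝ (fun p => (ν p).real (onesEvent S)) (1 / 2))
    (hflip : ∀ T S : Finset (Fin n), S ⊆ T → ∀ p ∈ Set.Ioo (0 : ℝ) 1,
      ν p (zeroOneEvent S (T \ S)) = ν (1 - p) (zeroOneEvent (T \ S) S)) :
    {q : SetPart n → ℝ | ∃ Q : ℝ → SetPart n → ℝ,
        (∀ p ∈ Set.Ioo (0 : ℝ) 1, IsFormalSolution (ν p) p (Q p)) ∧ IsSubseqLimitAtHalf Q q} =
      {q : SetPart n → ℝ |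
        (∀ S : Finset (Fin n), Even S.card →
          ∑ σ : SetPart n, (2 : ℝ) ^ (-(restrictCard σ S : ℤ)) * q σ
            = (ν (1 / 2)).real (onesEvent S)) ∧
        (∀ S : Finset (Fin n), Odd S.card →
          ∑ σ : SetPart n, (restrictCard σ S : ℝ) * (2 : ℝ) ^ (-(restrictCard σ S : ℤ) + 1) * q σ
            = deriv (fun p => (ν p).real (onesEvent S)) (1 / 2))} := by
  have hflip' : ∀ p ∈ Set.Ioo (0 : ℝ) 1, ∀ (q : SetPart n → ℝ) T,
      formalDefect (ν (1 - p)) q (1 - p) T =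
        ∑ S ∈ T.powerset, (-1) ^ S.card * formalDefect (ν p) q p S := by
    intro p hp q T
    have := hprob p hp
    refine formalDefect_one_sub q p T ?_
    simpa using hflip T T subset_rfl p hp
  ext q
  simp only [Set.mem_ofPred_eq]
  constructor
  · rintro ⟨Q, hQ, u, hu, hlim, hQlim⟩
    have hQσ : ∀ σ, Tendsto (fun k => Q (u k) σ) atTop (𝓝 (q σ)) := tendsto_pi_nhds.1 hQlim
    have hlim' : Tendsto u atTop (𝓝[≠] (1 / 2)) :=
      tendsto_nhdsWithin_iff.2 ⟨hlim, Eventually.of_forall fun k => (hu k).2⟩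
    constructor
    · intro S _
      have h1 : Tendsto (fun k => ∑ σ, u k ^ restrictCard σ S * Q (u k) σ) atTop
          (𝓝 (∑ σ, (1 / 2) ^ restrictCard σ S * q σ)) :=
        tendsto_finsetSum _ fun σ _ => (hlim.pow _).mul (hQσ σ)
      simp_rw [half_pow_eq] at h1
      refine tendsto_nhds_unique h1 (((hdiff S).continuousAt.tendsto.comp hlim).congr fun k => ?_)
      exact (hQ _ (hu k).1 S).symm
    · intro S _
      have h1 := (hdiff S).hasDerivAt.tendsto_sub_reflect_div.comp hlim'
      have h2 : Tendsto (fun k => ∑ σ, (u k ^ restrictCard σ S - (1 - u k) ^ restrictCard σ S) /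
          (2 * u k - 1) * Q (u k) σ) atTop
          (𝓝 (∑ σ, (restrictCard σ S : ℝ) * (2 : ℝ) ^ (-(restrictCard σ S : ℤ) + 1) * q σ)) := by
        refine tendsto_finsetSum _ fun σ _ => Tendsto.mul ?_ (hQσ σ)
        rw [← mul_half_pow_eq]
        exact (hasDerivAt_pow (restrictCard σ S) (1 / 2 : ℝ)).tendsto_sub_reflect_div.comp hlim'
      refine tendsto_nhds_unique h2 (h1.congr fun k => ?_)
      have h3 := hQ _ (hu k).1
      -- The same vector solves at the reflected parameter, so subtracting the two equations leaves
      -- no difference of `Q` values.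
      have h4 : IsFormalSolution (ν (1 - u k)) (1 - u k) (Q (u k)) := by
        rw [isFormalSolution_iff_formalDefect] at h3 ⊢
        intro T
        rw [hflip' _ (hu k).1]
        exact Finset.sum_eq_zero fun U _ => by rw [h3 U, mul_zero]
      simp only [Function.comp_apply]
      rw [← h3 S, ← h4 S, ← Finset.sum_sub_distrib, Finset.sum_div]
      exact Finset.sum_congr rfl fun σ _ => by ring
  · rintro ⟨heven, hodd⟩
    have hD : ∀ S, HasDerivAt (fun p => formalDefect (ν p) q p S) _ (1 / 2) := fun S =>
      (hdiff S).hasDerivAt.sub (hasDerivAt_sum_pow_restrictCard q S)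
    have hzero := eq_zero_and_deriv_eq_zero_of_reflect hD (fun p hp T => hflip' p hp q T)
      (fun S hS => by
        rw [formalDefect, ← heven S hS]
        simp_rw [half_pow_eq]
        exact sub_self _)
      (fun S hS => by rw [hodd S hS, sub_self])
    have hd0 := fun S => (hzero S).1
    have hd : ∀ S, HasDerivAt (fun p => formalDefect (ν p) q p S) 0 (1 / 2) := fun S => by
      have := hD S
      rwa [(hzero S).2] at this
    have hr : ∀ T : Finset (Fin n), ∃ r : SetPart n → ℝ, T.card ≠ 1 →
        ∀ p ∈ Set.Ioo (0 : ℝ) 1, ∀ S, ∑ σ, p ^ restrictCard σ S * r σ =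
          if T ⊆ S then p ^ (S \ T).card * topWeight T.card p else 0 := fun T => by
      by_cases hT : T.card = 1
      · exact ⟨0, fun h => absurd hT h⟩
      · obtain ⟨r, hr⟩ := exists_signed_setPart T hT
        exact ⟨r, fun _ => hr⟩
    choose r hr using hr
    have hy0 : ∀ T, correctionCoeff (1 / 2) (formalDefect (ν (1 / 2)) q (1 / 2)) T = 0 := fun T =>
      Finset.sum_eq_zero fun U _ => by rw [hd0, mul_zero]
    refine ⟨fun p σ => q σ + ∑ T, correctionCoeff p (formalDefect (ν p) q p) T /
      topWeight T.card p * r T σ, fun p hp => ?_, ?_⟩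
    · intro S
      simp only [mul_add, Finset.sum_add_distrib]
      -- The family must also solve at `1/2`, where odd weights vanish; there all coefficients are
      -- zero and `q` itself is a solution.
      by_cases hp2 : p = 1 / 2
      · subst hp2
        simp only [hy0, zero_div, zero_mul, Finset.sum_const_zero, mul_zero, add_zero]
        exact isFormalSolution_iff_formalDefect.2 hd0 S
      · rw [sum_correction hp hp2 _ fun T hT => hr T hT p hp]
        · simp [formalDefect]
        -- The marginal condition gives `d {i} = p * d ∅`, since `‖σ_{i}‖ = 1` and `‖σ_∅‖ = 0` for
        -- every `σ`.
        · intro i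
          have := hprob p hp
          have h1 : onesEvent (∅ : Finset (Fin n)) = Set.univ := by simp [onesEvent]
          simp [formalDefect, restrictCard_eq_card_image, h1, mul_sub, Finset.mul_sum,
            measureReal_onesEvent_singleton hp.1.le (hmarg p hp) i]
    · obtain ⟨u, hu, hlim⟩ := exists_seq_tendsto_half
      refine ⟨u, hu, hlim, tendsto_pi_nhds.2 fun σ => ?_⟩
      have hlim' : Tendsto u atTop (𝓝[≠] (1 / 2)) :=
        tendsto_nhdsWithin_iff.2 ⟨hlim, Eventually.of_forall fun k => (hu k).2⟩
      have hy := hasDerivAt_correctionCoeff (d := fun p => formalDefect (ν p) q p) hd0 hd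
      have h1 : Tendsto (fun k => q σ + ∑ T, correctionCoeff (u k)
          (formalDefect (ν (u k)) q (u k)) T / topWeight T.card (u k) * r T σ) atTop
          (𝓝 (q σ + ∑ T : Finset (Fin n), 0 * r T σ)) :=
        tendsto_const_nhds.add (tendsto_finsetSum _ fun T _ => Tendsto.mul_const _
          ((tendsto_div_topWeight (hy0 T) (hy T) T.card).comp hlim'))
      simpa using h1
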